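/- Definitions. For a set $S$ let $\mathrm{Sym}^m(S)$ be the set of $m$-element multisets in $S$ (entries counted with multiplicity); if $S$ is a topological space, $\mathrm{Sym}^m(S)$ carries the quotient topology from $S^m$. A map $S\to \mathrm{Sym}^m(X)$ is applied to a multiset entry by entry, with multiplicities. An $m$-valued group is a set $A$ with a map $*:A\times A\to \mathrm{Sym}^m(A)$, an element $e$ and a map $\mathrm{inv}:A\to A$ such that for all $x,y,z\in A$: the $m^2$-element multisets $x*(y*z)$ and $(x*y)*z$ are equal; $e*x=x*e=[x,\dots,x]$; $e\in \mathrm{inv}(x)*x$ and $e\in x*\mathrm{inv}(x)$. A (continuous) action of $A$ on a topological space $S$ is a map $\nu:A\times S\to \mathrm{Sym}^m(S)$, with $\nu(a,\cdot)$ continuous for every $a\in A$, such that the $m^2$-element multisets $\nu(a_1,\nu(a_2,s))$ and $\nu(a_1*a_2,s)$ are equal and $\nu(e,s)=[s,\dots,s]$. A map $T:S\to \mathrm{Sym}^m(S)$ is defined by the action of an $m$-valued group if $T=\nu(a,\cdot)$ for some $m$-valued group $A$, some such action $\nu$ of $A$ on $S$ and some $a\in A$. For $p_1,p_0\in\mathbb{C}[z]$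 let $T=T_{p_1,p_0}:\mathbb{C}\to \mathrm{Sym}^2(\mathbb{C})$ be the 2-valued dynamics sending $z$ to the multiset of roots $w$ of $w^2+2p_1(z)w+p_0(z)$, that is, $T(z)=-p_1(z)\pm\sqrt{p_1(z)^2-p_0(z)}$. It is called non-degenerate if $T$ is not the composition of a continuous map $\mathbb{C}\to\mathbb{C}^2$ with the projection $\mathbb{C}^2\to \mathrm{Sym}^2(\mathbb{C})$, and the multiset $T(T(z))$ consists of four distinct elements for some $z\in\mathbb{C}$. Call $T$ normalized if $0$ is a root of odd multiplicity of $p_1^2-p_0$. Theorem. (1) Let $T=T_{p_1,p_0}$ be non-degenerate and normalized. If $p_0$ has a root of odd multiplicity, then $T$ cannot be defined by the action of any 2-valued group. Equivalently, for $T$ to be defined by the action of a 2-valued group it is necessary that $p_0$ be a perfect square in $\mathbb{C}[z]$. (2) This condition is not sufficient: there is a non-degenerate normalized $T_{p_1,p_0}$ with $p_0$ a perfect square that cannot be defined by the action of any 2-valued group. (3) The normalization is always achieved by a translation: for every non-degenerate $T=T_{p_1,p_0}$ the polynomial $p_1^2-p_0$ has a root of odd multiplicity, and for each such root $a$ the conjugate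 dynamics $z\mapsto T(z+a)-a$ equals $T_{q_1,q_0}$ for some $q_1,q_0\in\mathbb{C}[z]$, is non-degenerate and normalized, and is defined by the action of a 2-valued group if and only if $T$ is. -/

import Mathlib

open Polynomial

universe u

/-- The projection `S ^ m → Sym ^ m (S)`, forgetting the order of the entries. -/
def symProj {S : Type*} {m : ℕ} (v : Fin m → S) : Sym S m :=
  ⟨Finset.univ.val.map v, by simp⟩

/-- The quotient topology on the symmetric power `Sym ^ m (S)`. -/
instance symTopologicalSpace {S : Type*} [TopologicalSpace S] {m : ℕ} :
    TopologicalSpace (Sym S m) :=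
  TopologicalSpace.coinduced (symProj (S := S) (m := m)) inferInstance

/-- The multiset of `m ^ 2` elements obtained by applying an `m`-valued map `f` to every entry of
a multiset of `m` elements, with multiplicities. -/
def symApply {X Y : Type*} {m : ℕ} (f : X → Sym Y m) (s : Sym X m) : Multiset Y :=
  (s : Multiset X).bind fun x => (f x : Multiset Y)

/-- An `m`-valued group structure on `X`. -/
structure MultivaluedGroup (m : ℕ) (X : Type*) where
  /-- the `m`-valued multiplication -/
  mul : X → X → Sym X m
  /-- the unit -/
  one : X
  /-- the inverse -/
  inv : X → X
  /-- associativity: `[x * (y * z)] = [(x * y) * z]` as multisets of `m ^ 2` elements -/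
  mul_assoc : ∀ x y z, symApply (fun w => mul x w) (mul y z) = symApply (fun w => mul w z) (mul x y)
  one_mul : ∀ x, mul one x = Sym.replicate m x
  mul_one : ∀ x, mul x one = Sym.replicate m x
  one_mem_inv_mul : ∀ x, one ∈ mul (inv x) x
  one_mem_mul_inv : ∀ x, one ∈ mul x (inv x)

/-- An action of an `m`-valued group `A` on a topological space `S` by continuous `m`-valued
dynamics `ν(a, ·) : S → Sym ^ m (S)`. -/
structure MultivaluedAction {m : ℕ} {A : Type*} (G : MultivaluedGroup m A)
    (S : Type*) [TopologicalSpace S] where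
  /-- the map `ν` -/
  act : A → S → Sym S m
  /-- `ν(a₁, ν(a₂, s)) = ν(a₁ * a₂, s)` as multisets of `m ^ 2` elements -/
  act_act : ∀ a₁ a₂ s, symApply (act a₁) (act a₂ s) = symApply (fun b => act b s) (G.mul a₁ a₂)
  one_act : ∀ s, act G.one s = Sym.replicate m s
  continuous_act : ∀ a, Continuous (act a)

/-- The `m`-valued dynamics `T` on `S` is defined by the (continuous) action of some `m`-valued
group `A` with some element `a ∈ A`. -/
def IsDefinedByAction.{w, v} {m : ℕ} {S : Type v} [TopologicalSpace S] (T : S → Sym S m) : Prop :=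
  ∃ (A : Type w) (G : MultivaluedGroup m A) (ν : MultivaluedAction G S) (a : A),
    ∀ s, T s = ν.act a s

/-- A 2-valued dynamics `T` on `ℂ` is non-degenerate if it is not the composition of a continuous
map `ℂ → ℂ ^ 2` with the projection to `Sym ^ 2 (ℂ)`, and `T (T z)` consists of four distinct
elements for some `z`. -/
def NonDegenerate (T : ℂ → Sym ℂ 2) : Prop :=
  (¬ ∃ f : ℂ → (Fin 2 → ℂ), Continuous f ∧ ∀ z, T z = symProj (f z)) ∧
    ∃ z, (symApply T (T z)).Nodup

theorem card_roots_quadratic (b c : ℂ) : (X ^ 2 + C (2 * b) * X + C c : ℂ[X]).roots.card = 2 := by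
  rw [IsAlgClosed.card_roots_eq_natDegree]
  compute_degree!

/-- The 2-valued dynamics sending `z` to the multiset of the roots `w` of
`w ^ 2 + 2 p₁(z) w + p₀(z)`. -/
noncomputable def quadraticDynamics (p₁ p₀ : ℂ[X]) (z : ℂ) : Sym ℂ 2 :=
  ⟨(X ^ 2 + C (2 * p₁.eval z) * X + C (p₀.eval z) : ℂ[X]).roots, card_roots_quadratic _ _⟩

/-- In other words `z ↦ -p₁(z) ± √(p₁(z) ^ 2 - p₀(z))`, for either choice `s` of the root. -/
theorem quadraticDynamics_eq (p₁ p₀ : ℂ[X]) (z s : ℂ)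
    (hs : s ^ 2 = (p₁.eval z) ^ 2 - p₀.eval z) :
    (quadraticDynamics p₁ p₀ z : Multiset ℂ) = {-p₁.eval z + s, -p₁.eval z - s} := by
  have h : (X ^ 2 + C (2 * p₁.eval z) * X + C (p₀.eval z) : ℂ[X]) =
      (X - C (-p₁.eval z + s)) * (X - C (-p₁.eval z - s)) := by
    have h0 : p₀.eval z = (p₁.eval z) ^ 2 - s ^ 2 := by rw [hs]; ring
    rw [h0]
    simp only [map_add, map_sub, map_mul, map_pow, map_neg, map_ofNat]
    ring
  change (X ^ 2 + C (2 * p₁.eval z) * X + C (p₀.eval z) : ℂ[X]).roots = _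
  rw [h, roots_mul (mul_ne_zero (X_sub_C_ne_zero _) (X_sub_C_ne_zero _)), roots_X_sub_C,
    roots_X_sub_C]
  rfl

/-! Write `D = p₁² - p₀` and `T z = {w, w'}`. If `T` is the action of `a` and `a * a = [b, b']`,
then the four values `-p₁(w) ± t`, `-p₁(w') ± t'` of `T ∘ T`, where `t² = D(w)` and `t'² = D(w')`,
split into the values of two continuous 2-valued maps `ν b` and `ν b'`. The elementary symmetric
functions of each are single-valued and continuous in `z`.

By connectedness of the plane minus finitely many points, the splitting is everywhere unmixed (`T w`
against `T w'`) or everywhere mixed. Unmixed would distinguish `w` from `w'` continuously around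
`0`, where `D` has odd order (`exists_mixed_splitting`). Mixed makes `t t'` single-valued and
continuous, although its square is the polynomial `D(w) D(w')` in `z`. Since `D` has odd order at
`0` and `w w' = p₀(z)`, an odd root of `p₀` where both `w` and `w'` vanish gives this polynomial a
zero of odd order; if only `w` vanishes, `t` itself gives the contradiction. For `p₁ = z + 1`, `p₀ =
1` the polynomial is `1 - 4z`, which refutes sufficiency. -/

open Filter Topology

/-! ### Monodromy of square roots around a zero of odd order. -/

theorem not_continuousAt_sq_eq_sub (a : ℂ) {r : ℝ} (hr : 0 < r) (g : ℂ → ℂ)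
    (hg : ∀ z, ‖z - a‖ = r → ContinuousAt g z) (h : ∀ z, ‖z - a‖ = r → g z ^ 2 = z - a) :
    False := by
  have hr0 : (r : ℂ) ≠ 0 := by exact_mod_cast hr.ne'
  let c : ℝ → ℂ := fun t => a + r * Complex.exp (t * Complex.I)
  have hc : ∀ t, ‖c t - a‖ = r := fun t => by
    simp [c, Complex.norm_exp_ofReal_mul_I, abs_of_pos hr]
  have hcc : Continuous c := by fun_prop
  -- The half-angle factor cancels the winding: `q² = r`, so the continuous `q` is constant. Yet one
  -- full turn closes the circle and flips the sign of this factor.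
  let q : ℝ → ℂ := fun t => g (c t) * Complex.exp (-(t / 2 * Complex.I))
  have hq : Continuous q := by
    refine Continuous.mul ?_ (by fun_prop)
    exact continuous_iff_continuousAt.2 fun t =>
      ContinuousAt.comp (f := c) (hg _ (hc t)) hcc.continuousAt
  have hq2 : ∀ t, q t ^ 2 = r := fun t => by
    simp only [q, mul_pow, h _ (hc t), c, ← Complex.exp_nat_mul]
    rw [add_sub_cancel_left, mul_assoc, ← Complex.exp_add]
    convert mul_one (r : ℂ) using 2
    rw [← Complex.exp_zero]
    congr 1
    push_cast
    ring
  have hconst : q (2 * Real.pi) = q 0 := by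
    have := isPreconnected_univ (α := ℝ).eq_or_eq_neg_of_sq_eq hq.continuousOn
      (continuousOn_const (c := q 0)) (fun t _ => by simp [hq2]) (fun {t} _ h0 => by
        have := hq2 0
        rw [h0] at this
        exact hr0 (by rw [← this]; ring))
    rcases this with h1 | h1
    · exact h1 (Set.mem_univ _)
    · have h2 := h1 (Set.mem_univ (0 : ℝ))
      simp only [Pi.neg_apply] at h2
      have h3 := hq2 0
      have : q 0 = 0 := by linear_combination h2 / 2
      rw [this] at h3
      exact absurd h3.symm (by simpa using hr0)
  have h1 : q (2 * Real.pi) = - q 0 := by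
    have : c (2 * Real.pi) = c 0 := by simp [c, Complex.exp_two_pi_mul_I]
    simp only [q, this]
    have h2 : Complex.exp (-(((2 * Real.pi : ℝ) : ℂ) / 2 * Complex.I)) = -1 := by
      rw [show -(((2 * Real.pi : ℝ) : ℂ) / 2 * Complex.I) = -(Real.pi * Complex.I) by
        push_cast; ring, Complex.exp_neg, Complex.exp_pi_mul_I]
      norm_num
    rw [h2]
    simp
  have h3 := hq2 0
  have : q 0 = 0 := by linear_combination (h1 - hconst) / 2
  rw [this] at h3
  exact absurd h3.symm (by simpa using hr0)

theorem exists_sqrt_continuousAt {u : ℂ → ℂ} {a t : ℂ} (hu : ∀ᶠ z in 𝓝 a, ContinuousAt u z)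
    (ht : t ^ 2 = u a) (ht0 : t ≠ 0) :
    ∃ v : ℂ → ℂ, v a = t ∧ ∀ᶠ z in 𝓝 a, ContinuousAt v z ∧ v z ^ 2 = u z ∧ v z ≠ 0 := by
  have h0 : u a ≠ 0 := by rw [← ht]; exact pow_ne_zero 2 ht0
  refine ⟨fun z => t * Complex.exp (Complex.log (u z / u a) / 2), by simp [h0], ?_⟩
  have hs : ∀ᶠ z in 𝓝 a, u z / u a ∈ Complex.slitPlane := by
    have : ContinuousAt (fun z => u z / u a) a := hu.self_of_nhds.div_const _
    refine this.eventually_mem ?_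
    rw [div_self h0]
    exact Complex.isOpen_slitPlane.mem_nhds (by simp)
  filter_upwards [hu, hs] with z hz hs
  refine ⟨?_, ?_, mul_ne_zero ht0 (Complex.exp_ne_zero _)⟩
  · exact continuousAt_const.mul (((hz.div_const _).clog hs).div_const 2).cexp
  · rw [mul_pow, ← Complex.exp_nat_mul, ht]
    rw [show ((2 : ℕ) : ℂ) * (Complex.log (u z / u a) / 2) = Complex.log (u z / u a) by
      push_cast; ring, Complex.exp_log (Complex.slitPlane_ne_zero hs)]
    field_simp

/-- Dividing `f` by `(z - a) ^ k` and a local root of `u` leaves a root of `z - a` on a small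
circle. Only punctured neighbourhoods are needed for `f`, so it may be a quotient that breaks down
at `a`. -/
theorem not_eventually_sq_eq_odd_pow_mul {f u : ℂ → ℂ} {a : ℂ} {n : ℕ} (hn : Odd n)
    (hf : ∀ᶠ z in 𝓝[≠] a, ContinuousAt f z) (hu : ∀ᶠ z in 𝓝 a, ContinuousAt u z) (h0 : u a ≠ 0)
    (h : ∀ᶠ z in 𝓝[≠] a, f z ^ 2 = (z - a) ^ n * u z) : False := by
  obtain ⟨t, ht⟩ := IsAlgClosed.exists_pow_nat_eq (u a) (n := 2) (by norm_num)
  have ht0 : t ≠ 0 := fun h1 => h0 (by rw [← ht, h1]; ring)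
  obtain ⟨v, -, hv⟩ := exists_sqrt_continuousAt hu ht ht0
  obtain ⟨k, rfl⟩ := hn
  have h1 := (hf.and h).and (hv.filter_mono nhdsWithin_le_nhds)
  rw [eventually_nhdsWithin_iff, Metric.eventually_nhds_iff] at h1
  obtain ⟨ε, hε, h1⟩ := h1
  have h2 : ∀ z, ‖z - a‖ = ε / 2 → z ≠ a ∧ (ContinuousAt f z ∧ f z ^ 2 = (z - a) ^ (2 * k + 1) * u z)
      ∧ ContinuousAt v z ∧ v z ^ 2 = u z ∧ v z ≠ 0 := fun z hz => by
    have hza : z ≠ a := by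
      rintro rfl
      simp at hz
      linarith
    exact ⟨hza, h1 (by rw [dist_eq_norm, hz]; linarith) hza⟩
  refine not_continuousAt_sq_eq_sub a (half_pos hε) (fun z => f z / ((z - a) ^ k * v z)) ?_ ?_
  · intro z hz
    obtain ⟨hza, ⟨hf, -⟩, hv, -, hv0⟩ := h2 z hz
    exact hf.div (by fun_prop) (mul_ne_zero (pow_ne_zero _ (sub_ne_zero.2 hza)) hv0)
  · intro z hz
    obtain ⟨hza, ⟨-, hf⟩, -, hv, hv0⟩ := h2 z hz
    have := sub_ne_zero.2 hza
    rw [div_pow, hf, mul_pow, hv, ← hv]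
    field_simp
    ring

/-! ### Roots of complex polynomials and their parity. -/

theorem Polynomial.exists_eq_pow_rootMultiplicity_mul_eval_ne_zero {p : ℂ[X]} (hp : p ≠ 0) (a : ℂ) :
    ∃ q : ℂ[X], p = (X - C a) ^ p.rootMultiplicity a * q ∧ q.eval a ≠ 0 := by
  obtain ⟨q, hq, hd⟩ := exists_eq_pow_rootMultiplicity_mul_and_not_dvd p hp a
  exact ⟨q, hq, fun h => hd (dvd_iff_isRoot.2 h)⟩

theorem Polynomial.ne_zero_of_odd_rootMultiplicity {p : ℂ[X]} {a : ℂ}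
    (h : Odd (p.rootMultiplicity a)) : p ≠ 0 := by
  rintro rfl
  simp at h

theorem Polynomial.not_eventually_sq_eq_eval {f : ℂ → ℂ} {a : ℂ} {p : ℂ[X]}
    (hp : Odd (p.rootMultiplicity a)) (hf : ∀ᶠ z in 𝓝[≠] a, ContinuousAt f z)
    (h : ∀ᶠ z in 𝓝[≠] a, f z ^ 2 = p.eval z) : False := by
  obtain ⟨q, hq, hqa⟩ :=
    exists_eq_pow_rootMultiplicity_mul_eval_ne_zero (ne_zero_of_odd_rootMultiplicity hp) a
  refine not_eventually_sq_eq_odd_pow_mul (u := fun z => q.eval z) hp hf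
    (Eventually.of_forall fun z => q.continuous.continuousAt) hqa ?_
  filter_upwards [h] with z hz
  rw [hz]
  conv_lhs => rw [hq]
  simp

theorem Polynomial.isSquare_of_forall_even_rootMultiplicity {p : ℂ[X]}
    (h : ∀ a, ¬ Odd (p.rootMultiplicity a)) : IsSquare p := by
  rw [(IsAlgClosed.splits p).eq_prod_roots]
  refine IsSquare.mul ?_ ?_
  · exact (IsAlgClosed.exists_eq_mul_self p.leadingCoeff).elim fun x hx =>
      ⟨C x, by rw [hx, C_mul]⟩
  · rw [Finset.prod_multiset_map_count]
    refine Finset.isSquare_prod _ fun a _ => ?_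
    rw [count_roots]
    exact (Nat.not_odd_iff_even.1 (h a)).isSquare_pow _

theorem Polynomial.finite_eval_eq_zero {p : ℂ[X]} (hp : p ≠ 0) : {z | p.eval z = 0}.Finite :=
  p.roots.toFinset.finite_toSet.subset fun z (hz : p.eval z = 0) => by simpa [hp] using hz

theorem Polynomial.eventually_eval_ne_zero {p : ℂ[X]} (hp : p ≠ 0) (a : ℂ) :
    ∀ᶠ z in 𝓝[≠] a, p.eval z ≠ 0 := by
  have h := ((finite_eval_eq_zero hp).sdiff (t := {a})).isClosed.isOpen_compl.mem_nhds (x := a) (by simp)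
  rw [eventually_nhdsWithin_iff]
  filter_upwards [h] with z hz hza h
  exact hz ⟨h, hza⟩

theorem Polynomial.isPreconnected_eval_ne_zero {p : ℂ[X]} (hp : p ≠ 0) :
    IsPreconnected {z : ℂ | p.eval z ≠ 0} := by
  have : {z : ℂ | p.eval z ≠ 0} = {z : ℂ | p.eval z = 0}ᶜ := rfl
  rw [this]
  refine (Set.Countable.isPathConnected_compl_of_one_lt_rank ?_ ?_).isConnected.isPreconnected
  · rw [Complex.rank_real_complex]; norm_num
  · exact (finite_eval_eq_zero hp).countable

/-! ### Symmetric powers and splittings of small multisets. -/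

theorem continuous_symProj {S : Type*} [TopologicalSpace S] {m : ℕ} :
    Continuous (symProj (S := S) (m := m)) :=
  continuous_coinduced_rng

theorem continuous_sym_sum : Continuous fun s : Sym ℂ 2 => (s : Multiset ℂ).sum := by
  refine continuous_coinduced_dom.2 ?_
  have : ((fun s : Sym ℂ 2 => (s : Multiset ℂ).sum) ∘ symProj) = fun v => v 0 + v 1 := by
    ext v
    change (Finset.univ.val.map v).sum = _
    simp
  rw [this]
  fun_prop

theorem continuous_sym_prod : Continuous fun s : Sym ℂ 2 => (s : Multiset ℂ).prod := by
  refine continuous_coinduced_dom.2 ?_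
  have : ((fun s : Sym ℂ 2 => (s : Multiset ℂ).prod) ∘ symProj) = fun v => v 0 * v 1 := by
    ext v
    change (Finset.univ.val.map v).prod = _
    simp
  rw [this]
  fun_prop

theorem Sym.exists_eq_pair {S : Type*} (s : Sym S 2) : ∃ x y, (s : Multiset S) = {x, y} :=
  Multiset.card_eq_two.1 s.2

theorem symApply_of_eq_pair {S Y : Type*} {f : S → Sym Y 2} {s : Sym S 2} {x y : S}
    (h : (s : Multiset S) = {x, y}) : symApply f s = (f x : Multiset Y) + (f y : Multiset Y) := by
  rw [symApply, h]
  simp [Multiset.insert_eq_cons]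

theorem coe_symProj_two {S : Type*} (v : Fin 2 → S) : (symProj v : Multiset S) = {v 0, v 1} := by
  change Finset.univ.val.map v = _
  rfl

theorem Sym.map_symProj {S Y : Type*} {m : ℕ} (φ : S → Y) (v : Fin m → S) :
    (symProj v).map φ = symProj fun i => φ (v i) := by
  apply Sym.coe_injective
  change ((Finset.univ : Finset (Fin m)).val.map v).map φ =
    (Finset.univ : Finset (Fin m)).val.map fun i => φ (v i)
  rw [Multiset.map_map]
  rfl

theorem Sym.continuous_map {S Y : Type*} [TopologicalSpace S] [TopologicalSpace Y] {m : ℕ}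
    {φ : S → Y} (hφ : Continuous φ) : Continuous fun s : Sym S m => s.map φ := by
  refine continuous_coinduced_dom.2 ?_
  have : ((fun s : Sym S m => s.map φ) ∘ symProj) = fun v => symProj fun i => φ (v i) :=
    funext fun v => Sym.map_symProj φ v
  rw [this]
  exact continuous_symProj.comp (by fun_prop)

theorem Multiset.cons_eq_triple {S : Type*} {x b c d : S} {p : Multiset S}
    (h : x ::ₘ p = {b, c, d}) :
    (x = b ∧ p = {c, d}) ∨ (x = c ∧ p = {b, d}) ∨ (x = d ∧ p = {b, c}) := by
  have hx : x ∈ ({b, c, d} : Multiset S) := h ▸ Multiset.mem_cons_self x p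
  simp only [Multiset.insert_eq_cons, Multiset.mem_cons, Multiset.mem_singleton] at hx h ⊢
  rcases hx with rfl | rfl | rfl
  · exact Or.inl ⟨rfl, (Multiset.cons_inj_right _).1 h⟩
  · rw [Multiset.cons_swap] at h
    exact Or.inr (Or.inl ⟨rfl, (Multiset.cons_inj_right _).1 h⟩)
  · rw [← Multiset.cons_zero x, Multiset.cons_swap c, Multiset.cons_swap b] at h
    exact Or.inr (Or.inr ⟨rfl, (Multiset.cons_inj_right _).1 h⟩)

theorem Multiset.cons_eq_quadruple {S : Type*} {x a b c d : S} {p : Multiset S}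
    (h : x ::ₘ p = {a, b, c, d}) :
    (x = a ∧ p = {b, c, d}) ∨ (x = b ∧ p = {a, c, d}) ∨ (x = c ∧ p = {a, b, d}) ∨
      (x = d ∧ p = {a, b, c}) := by
  have hx : x ∈ ({a, b, c, d} : Multiset S) := h ▸ Multiset.mem_cons_self x p
  simp only [Multiset.insert_eq_cons, Multiset.mem_cons, Multiset.mem_singleton] at hx h ⊢
  rcases hx with rfl | rfl | rfl | rfl
  · exact Or.inl ⟨rfl, (Multiset.cons_inj_right _).1 h⟩
  · rw [Multiset.cons_swap] at h
    exact Or.inr (Or.inl ⟨rfl, (Multiset.cons_inj_right _).1 h⟩)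
  · rw [Multiset.cons_swap b, Multiset.cons_swap a] at h
    exact Or.inr (Or.inr (Or.inl ⟨rfl, (Multiset.cons_inj_right _).1 h⟩))
  · rw [← Multiset.cons_zero x, Multiset.cons_swap c, Multiset.cons_swap b,
      Multiset.cons_swap a] at h
    exact Or.inr (Or.inr (Or.inr ⟨rfl, (Multiset.cons_inj_right _).1 h⟩))

/-- Two ways of splitting a four-element multiset into pairs either coincide or every pair of the
second splitting takes one entry of each pair of the first. -/
theorem Multiset.pair_add_pair_cases {S : Type*} {a b c d x x' y y' : S}
    (h : ({a, b} : Multiset S) + {c, d} = {x, x'} + {y, y'}) :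
    (({x, x'} : Multiset S) = {a, b} ∧ ({y, y'} : Multiset S) = {c, d}) ∨
    (({x, x'} : Multiset S) = {c, d} ∧ ({y, y'} : Multiset S) = {a, b}) ∨
    ∃ a' b' c' d', ({a', b'} : Multiset S) = {a, b} ∧ ({c', d'} : Multiset S) = {c, d} ∧
      ({x, x'} : Multiset S) = {a', c'} ∧ ({y, y'} : Multiset S) = {b', d'} := by
  have h1 : x ::ₘ x' ::ₘ {y, y'} = ({a, b, c, d} : Multiset S) := h.symm
  rcases cons_eq_quadruple h1 with ⟨rfl, h2⟩ | ⟨rfl, h2⟩ | ⟨rfl, h2⟩ | ⟨rfl, h2⟩ <;>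
  rcases cons_eq_triple h2 with ⟨rfl, h3⟩ | ⟨rfl, h3⟩ | ⟨rfl, h3⟩
  · exact Or.inl ⟨rfl, h3⟩
  · exact Or.inr (Or.inr ⟨_, _, _, _, rfl, rfl, rfl, h3⟩)
  · exact Or.inr (Or.inr ⟨_, _, _, _, rfl, pair_comm _ _, rfl, h3⟩)
  · exact Or.inl ⟨pair_comm _ _, h3⟩
  · exact Or.inr (Or.inr ⟨_, _, _, _, pair_comm _ _, rfl, rfl, h3⟩)
  · exact Or.inr (Or.inr ⟨_, _, _, _, pair_comm _ _, pair_comm _ _, rfl, h3⟩)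
  · exact Or.inr (Or.inr ⟨_, _, _, _, rfl, rfl, pair_comm _ _, h3⟩)
  · exact Or.inr (Or.inr ⟨_, _, _, _, pair_comm _ _, rfl, pair_comm _ _, h3⟩)
  · exact Or.inr (Or.inl ⟨rfl, h3⟩)
  · exact Or.inr (Or.inr ⟨_, _, _, _, rfl, pair_comm _ _, pair_comm _ _, h3⟩)
  · exact Or.inr (Or.inr ⟨_, _, _, _, pair_comm _ _, pair_comm _ _, pair_comm _ _, h3⟩)
  · exact Or.inr (Or.inl ⟨pair_comm _ _, h3⟩)

theorem add_eq_of_pair_eq {x y x' y' : ℂ} (h : ({x, y} : Multiset ℂ) = {x', y'}) :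
    x + y = x' + y' := by
  simpa using congrArg Multiset.sum h

theorem mul_eq_of_pair_eq {x y x' y' : ℂ} (h : ({x, y} : Multiset ℂ) = {x', y'}) :
    x * y = x' * y' := by
  simpa using congrArg Multiset.prod h

/-! ### The splitting of `T ∘ T` forced by an action. -/

variable {p₁ p₀ : ℂ[X]}

theorem quadraticDynamics_exists_sqrt (p₁ p₀ : ℂ[X]) (z : ℂ) :
    ∃ s, s ^ 2 = (p₁ ^ 2 - p₀).eval z ∧
      (quadraticDynamics p₁ p₀ z : Multiset ℂ) = {-p₁.eval z + s, -p₁.eval z - s} := by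
  obtain ⟨s, hs⟩ := IsAlgClosed.exists_pow_nat_eq ((p₁ ^ 2 - p₀).eval z) (n := 2) (by norm_num)
  exact ⟨s, hs, quadraticDynamics_eq _ _ _ _ (by rw [hs]; simp)⟩

theorem quadraticDynamics_vieta {z w w' : ℂ}
    (h : (quadraticDynamics p₁ p₀ z : Multiset ℂ) = {w, w'}) :
    w + w' = -(2 * p₁.eval z) ∧ w * w' = p₀.eval z := by
  obtain ⟨s, hs, h1⟩ := quadraticDynamics_exists_sqrt p₁ p₀ z
  rw [h] at h1
  simp only [eval_sub, eval_pow] at hs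
  constructor
  · linear_combination add_eq_of_pair_eq h1
  · linear_combination mul_eq_of_pair_eq h1 - hs

/-- With `a * a = [b, b']`, `σ` and `π` are the sum and product of `ν b`, and `π'` is the product of
`ν b'`. The first two alternatives are the unmixed splittings, the third is the mixed one. -/
theorem IsDefinedByAction.exists_splitting
    (h : IsDefinedByAction.{u} (quadraticDynamics p₁ p₀)) :
    ∃ σ π π' : ℂ → ℂ, Continuous σ ∧ Continuous π ∧ Continuous π' ∧
      ∀ z w w', (quadraticDynamics p₁ p₀ z : Multiset ℂ) = {w, w'} →
        (σ z = -(2 * p₁.eval w) ∧ π z = p₀.eval w ∧ π' z = p₀.eval w') ∨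
        (σ z = -(2 * p₁.eval w') ∧ π z = p₀.eval w' ∧ π' z = p₀.eval w) ∨
        ∃ t t', t ^ 2 = (p₁ ^ 2 - p₀).eval w ∧ t' ^ 2 = (p₁ ^ 2 - p₀).eval w' ∧
          σ z = (t - p₁.eval w) + (t' - p₁.eval w') ∧
          π z = (t - p₁.eval w) * (t' - p₁.eval w') ∧
          π' z = (t + p₁.eval w) * (t' + p₁.eval w') := by
  obtain ⟨A, G, ν, a, hT⟩ := h
  obtain ⟨b, b', hb⟩ := (G.mul a a).exists_eq_pair
  refine ⟨fun z => (ν.act b z : Multiset ℂ).sum, fun z => (ν.act b z : Multiset ℂ).prod,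
    fun z => (ν.act b' z : Multiset ℂ).prod, continuous_sym_sum.comp (ν.continuous_act b),
    continuous_sym_prod.comp (ν.continuous_act b), continuous_sym_prod.comp (ν.continuous_act b'),
    fun z w w' hw => ?_⟩
  obtain ⟨x, x', hx⟩ := (ν.act b z).exists_eq_pair
  obtain ⟨y, y', hy⟩ := (ν.act b' z).exists_eq_pair
  obtain ⟨α, β, hα⟩ := (quadraticDynamics p₁ p₀ w).exists_eq_pair
  obtain ⟨γ, δ, hγ⟩ := (quadraticDynamics p₁ p₀ w').exists_eq_pair
  have h := ν.act_act a a z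
  rw [symApply_of_eq_pair hb, hx, hy, symApply_of_eq_pair (by rw [← hT]; exact hw), ← hT, ← hT,
    hα, hγ] at h
  obtain ⟨v1, v2⟩ := quadraticDynamics_vieta hα
  obtain ⟨v3, v4⟩ := quadraticDynamics_vieta hγ
  simp only [hx, hy, Multiset.sum_pair, Multiset.prod_pair]
  rcases Multiset.pair_add_pair_cases h with ⟨h1, h2⟩ | ⟨h1, h2⟩ | ⟨α', β', γ', δ', h1, h2, h3, h4⟩
  · exact Or.inl ⟨(add_eq_of_pair_eq h1).trans v1, (mul_eq_of_pair_eq h1).trans v2,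
      (mul_eq_of_pair_eq h2).trans v4⟩
  · exact Or.inr (Or.inl ⟨(add_eq_of_pair_eq h1).trans v3, (mul_eq_of_pair_eq h1).trans v4,
      (mul_eq_of_pair_eq h2).trans v2⟩)
  · rw [← add_eq_of_pair_eq h1] at v1
    rw [← mul_eq_of_pair_eq h1] at v2
    rw [← add_eq_of_pair_eq h2] at v3
    rw [← mul_eq_of_pair_eq h2] at v4
    -- Adding `p₁(w)` centres `T w` at `0`, so its entries become the two square roots of `D(w)`.
    refine Or.inr (Or.inr ⟨α' + p₁.eval w, γ' + p₁.eval w', ?_, ?_, ?_, ?_, ?_⟩)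
    · simp only [eval_sub, eval_pow]
      linear_combination α' * v1 - v2
    · simp only [eval_sub, eval_pow]
      linear_combination γ' * v3 - v4
    · rw [add_eq_of_pair_eq h3]; ring
    · rw [mul_eq_of_pair_eq h3]; ring
    · rw [mul_eq_of_pair_eq h4, show β' = -(2 * p₁.eval w) - α' by linear_combination v1,
        show δ' = -(2 * p₁.eval w') - γ' by linear_combination v3]
      ring

/-- Reduction modulo `s² = D`: the extension of `ℂ[z]` by `s` has basis `1, s`. -/
theorem exists_eval_add_sqrt (D q f : ℂ[X]) :
    ∃ A B : ℂ[X], ∀ z s, s ^ 2 = D.eval z → f.eval (q.eval z + s) = A.eval z + s * B.eval z := by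
  induction f using Polynomial.induction_on with
  | C a => exact ⟨C a, 0, by simp⟩
  | add f g hf hg =>
    obtain ⟨A, B, h⟩ := hf
    obtain ⟨A', B', h'⟩ := hg
    refine ⟨A + A', B + B', fun z s hs => ?_⟩
    simp only [eval_add, h z s hs, h' z s hs]
    ring
  | monomial n a h =>
    obtain ⟨A, B, h⟩ := h
    refine ⟨A * q + D * B, A + B * q, fun z s hs => ?_⟩
    rw [pow_succ, ← mul_assoc, eval_mul, h z s hs]
    simp only [eval_X, eval_add, eval_mul]
    rw [← hs]
    ring

/-- The product is the norm `A² - D B²`, invariant under `s ↦ -s`. -/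
theorem exists_eval_mul_eval (p₁ p₀ f : ℂ[X]) :
    ∃ N : ℂ[X], ∀ z w w', (quadraticDynamics p₁ p₀ z : Multiset ℂ) = {w, w'} →
      f.eval w * f.eval w' = N.eval z := by
  obtain ⟨A, B, h⟩ := exists_eval_add_sqrt (p₁ ^ 2 - p₀) (-p₁) f
  refine ⟨A ^ 2 - (p₁ ^ 2 - p₀) * B ^ 2, fun z w w' hw => ?_⟩
  obtain ⟨s, hs, h1⟩ := quadraticDynamics_exists_sqrt p₁ p₀ z
  rw [hw] at h1
  have h2 := congrArg (fun m => (m.map fun x => f.eval x).prod) h1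
  simp only [Multiset.insert_eq_cons, Multiset.map_cons, Multiset.map_singleton,
    Multiset.prod_cons, Multiset.prod_singleton] at h2
  have h3 := h z s hs
  have h4 := h z (-s) (by rw [← hs]; ring)
  rw [eval_neg] at h3 h4
  rw [← sub_eq_add_neg] at h4
  rw [h2, h3, h4, eval_sub, eval_mul, ← hs]
  simp only [eval_pow]
  ring

theorem Polynomial.odd_rootMultiplicity_mul_sq {p q : ℂ[X]} {a : ℂ}
    (hp : Odd (p.rootMultiplicity a)) (hq : q ≠ 0) : Odd ((p * q ^ 2).rootMultiplicity a) := by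
  rw [rootMultiplicity_mul (mul_ne_zero (ne_zero_of_odd_rootMultiplicity hp) (pow_ne_zero 2 hq)),
    pow_two, rootMultiplicity_mul (mul_ne_zero hq hq)]
  exact hp.add_even (Even.add_self _)

/-! ### Excluding the unmixed splitting. -/

/-- If the dynamics `T` is defined by an action, then `T ∘ T` splits into two continuous 2-valued
maps, each of which generically takes one value from each of the pairs `T w`, `T w'`, where
`T z = [w, w']`. -/
theorem exists_mixed_splitting (hnd : NonDegenerate (quadraticDynamics p₁ p₀))
    (hodd : Odd ((p₁ ^ 2 - p₀).rootMultiplicity 0))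
    (hT : IsDefinedByAction.{u} (quadraticDynamics p₁ p₀)) :
    ∃ (R : ℂ[X]) (σ π π' : ℂ → ℂ), R ≠ 0 ∧ Continuous σ ∧ Continuous π ∧ Continuous π' ∧
      ∀ z w w', R.eval z ≠ 0 → (quadraticDynamics p₁ p₀ z : Multiset ℂ) = {w, w'} →
        ∃ t t', t ^ 2 = (p₁ ^ 2 - p₀).eval w ∧ t' ^ 2 = (p₁ ^ 2 - p₀).eval w' ∧
          σ z = (t - p₁.eval w) + (t' - p₁.eval w') ∧
          π z = (t - p₁.eval w) * (t' - p₁.eval w') ∧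
          π' z = (t + p₁.eval w) * (t' + p₁.eval w') ∧
          σ z + 2 * p₁.eval w ≠ 0 := by
  obtain ⟨σ, π, π', hσ, hπ, hπ', hsplit⟩ := hT.exists_splitting
  obtain ⟨a, b, hab⟩ := exists_eval_add_sqrt (p₁ ^ 2 - p₀) (-p₁) p₁
  obtain ⟨c, d, hcd⟩ := exists_eval_add_sqrt (p₁ ^ 2 - p₀) (-p₁) p₀
  set D := p₁ ^ 2 - p₀ with hD
  have key : ∀ z, ∃ s, s ^ 2 = D.eval z ∧
      (quadraticDynamics p₁ p₀ z : Multiset ℂ) = {-p₁.eval z + s, -p₁.eval z - s} ∧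
      p₁.eval (-p₁.eval z + s) = a.eval z + s * b.eval z ∧
      p₁.eval (-p₁.eval z - s) = a.eval z - s * b.eval z ∧
      p₀.eval (-p₁.eval z + s) = c.eval z + s * d.eval z ∧
      p₀.eval (-p₁.eval z - s) = c.eval z - s * d.eval z := fun z => by
    obtain ⟨s, hs, h⟩ := quadraticDynamics_exists_sqrt p₁ p₀ z
    have hs' : (-s) ^ 2 = D.eval z := by rw [← hs]; ring
    have h1 := hab z s hs
    have h2 := hab z (-s) hs'
    have h3 := hcd z s hs
    have h4 := hcd z (-s) hs'
    simp only [eval_neg, neg_mul, ← sub_eq_add_neg] at h1 h2 h3 h4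
    exact ⟨s, hs, h, h1, h2, h3, h4⟩
  have hDe : ∀ w, D.eval w = p₁.eval w ^ 2 - p₀.eval w := fun w => by simp [hD]
  -- With `p₁(w) = a + s b` and `p₀(w) = c + s d`, `4 R` is the resultant of the quadratics defining
  -- `T w` and `T w'`: it vanishes exactly when these share a value.
  let R : ℂ[X] := D * (d ^ 2 - 4 * a * b * d + 4 * b ^ 2 * c)
  have hRe : ∀ z s, s ^ 2 = D.eval z → R.eval z = s ^ 2 * (d.eval z ^ 2 -
      4 * a.eval z * b.eval z * d.eval z + 4 * b.eval z ^ 2 * c.eval z) := fun z s hs => by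
    simp [R, hs]
  have hres : ∀ z w w' t t', (quadraticDynamics p₁ p₀ z : Multiset ℂ) = {w, w'} →
      t ^ 2 = D.eval w → t' ^ 2 = D.eval w' →
      ((p₁.eval w - p₁.eval w') ^ 2 - (t - t') ^ 2) *
        ((p₁.eval w - p₁.eval w') ^ 2 - (t + t') ^ 2) = 4 * R.eval z := by
    intro z w w' t t' hw ht ht'
    obtain ⟨s, hs, h, h1, h2, h3, h4⟩ := key z
    have e : ((p₁.eval w - p₁.eval w') ^ 2 - (t - t') ^ 2) *
        ((p₁.eval w - p₁.eval w') ^ 2 - (t + t') ^ 2) = (p₁.eval w - p₁.eval w') ^ 4 -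
          2 * (p₁.eval w - p₁.eval w') ^ 2 * (t ^ 2 + t' ^ 2) + (t ^ 2 - t' ^ 2) ^ 2 := by ring
    rw [e, ht, ht', hDe, hDe, hRe z s hs]
    rw [h] at hw
    have hcase : (w = -p₁.eval z + s ∧ w' = -p₁.eval z - s) ∨
        (w = -p₁.eval z - s ∧ w' = -p₁.eval z + s) := by
      have hsum := add_eq_of_pair_eq hw
      have : (w - (-p₁.eval z + s)) * (w - (-p₁.eval z - s)) = 0 := by
        linear_combination mul_eq_of_pair_eq hw - w * hsum
      rcases mul_eq_zero.1 this with h | h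
      · exact Or.inl ⟨sub_eq_zero.1 h, by linear_combination -hsum - h⟩
      · exact Or.inr ⟨sub_eq_zero.1 h, by linear_combination -hsum - h⟩
    rcases hcase with ⟨rfl, rfl⟩ | ⟨rfl, rfl⟩ <;> rw [h1, h2, h3, h4] <;> ring
  have hR : R ≠ 0 := by
    intro h0
    obtain ⟨z, hz⟩ := hnd.2
    obtain ⟨w, w', hw⟩ := (quadraticDynamics p₁ p₀ z).exists_eq_pair
    obtain ⟨t, ht, h1⟩ := quadraticDynamics_exists_sqrt p₁ p₀ w
    obtain ⟨t', ht', h2⟩ := quadraticDynamics_exists_sqrt p₁ p₀ w'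
    have h := hres z w w' t t' hw ht ht'
    rw [symApply_of_eq_pair hw, h1, h2] at hz
    obtain ⟨-, -, hd⟩ := Multiset.nodup_add.1 hz
    rw [Multiset.disjoint_left] at hd
    simp only [Multiset.insert_eq_cons, Multiset.mem_cons, Multiset.mem_singleton] at hd
    rw [h0, eval_zero, mul_zero] at h
    have : (-p₁.eval w + t - (-p₁.eval w' + t')) * (-p₁.eval w + t - (-p₁.eval w' - t')) *
        ((-p₁.eval w - t - (-p₁.eval w' + t')) * (-p₁.eval w - t - (-p₁.eval w' - t'))) = 0 := by
      linear_combination h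
    simp only [mul_eq_zero, sub_eq_zero] at this
    rcases this with (h | h) | h | h
    · exact hd (Or.inl rfl) (Or.inl h)
    · exact hd (Or.inl rfl) (Or.inr h)
    · exact hd (Or.inr rfl) (Or.inl h)
    · exact hd (Or.inr rfl) (Or.inr h)
  -- `N` is `p₁(w) p₁(w')` and `H` is `D(w) D(w')`. Unmixed splittings give `π + π' = p₀(w) + p₀(w')
  -- = 2c`, mixed ones `π + π' = 2N + 2tt'`. Since `R = (c - N)² - H`, the sets `F₁` and `F₂` are
  -- disjoint where `R ≠ 0`.
  let N : ℂ[X] := a ^ 2 - D * b ^ 2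
  let H : ℂ[X] := (a ^ 2 + D * b ^ 2 - c) ^ 2 - D * (2 * a * b - d) ^ 2
  let F₁ : Set ℂ := {z | π z + π' z = 2 * c.eval z}
  let F₂ : Set ℂ := {z | (π z + π' z - 2 * N.eval z) ^ 2 = 4 * H.eval z}
  have hF₁ : IsClosed F₁ := isClosed_eq (by fun_prop) (by fun_prop)
  have hF₂ : IsClosed F₂ := isClosed_eq (by fun_prop) (by fun_prop)
  have hdisj : ∀ z, R.eval z ≠ 0 → z ∈ F₁ → z ∉ F₂ := by
    intro z hz h1 h2
    simp only [F₁, F₂, Set.mem_ofPred_eq] at h1 h2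
    rw [h1] at h2
    apply hz
    simp only [R, N, H, eval_mul, eval_sub, eval_add, eval_pow, eval_ofNat] at h2 ⊢
    linear_combination h2 / 4
  have hunmixed : ∀ z w w', (quadraticDynamics p₁ p₀ z : Multiset ℂ) = {w, w'} →
      p₀.eval w + p₀.eval w' = 2 * c.eval z := by
    intro z w w' hw
    obtain ⟨s, hs, h, h1, h2, h3, h4⟩ := key z
    have h5 := congrArg (fun m => (m.map fun x => p₀.eval x).sum) (hw.symm.trans h)
    simp only [Multiset.insert_eq_cons, Multiset.map_cons, Multiset.map_singleton,
      Multiset.sum_cons, Multiset.sum_singleton, h3, h4] at h5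
    rw [h5]
    ring
  have hmixed : ∀ z, ∀ w w' t t', (quadraticDynamics p₁ p₀ z : Multiset ℂ) = {w, w'} →
      t ^ 2 = D.eval w → t' ^ 2 = D.eval w' →
      π z = (t - p₁.eval w) * (t' - p₁.eval w') →
      π' z = (t + p₁.eval w) * (t' + p₁.eval w') → z ∈ F₂ := by
    intro z w w' t t' hw ht ht' h1 h2
    obtain ⟨s, hs, h, h3, h4, h5, h6⟩ := key z
    have e1 := congrArg (fun m => (m.map fun x => p₁.eval x).prod) (hw.symm.trans h)
    have e2 := congrArg (fun m => (m.map fun x => D.eval x).prod) (hw.symm.trans h)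
    simp only [Multiset.insert_eq_cons, Multiset.map_cons, Multiset.map_singleton,
      Multiset.prod_cons, Multiset.prod_singleton, hDe, h3, h4, h5, h6] at e1 e2
    rw [← hDe, ← hDe, ← ht, ← ht'] at e2
    simp only [F₂, Set.mem_ofPred_eq]
    have e3 : N.eval z = p₁.eval w * p₁.eval w' := by
      rw [e1]
      simp only [N, eval_sub, eval_mul, eval_pow, ← hs]
      ring
    have e4 : H.eval z = t ^ 2 * t' ^ 2 := by
      rw [e2]
      simp only [H, eval_sub, eval_add, eval_mul, eval_pow, eval_ofNat, ← hs]
      ring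
    rw [h1, h2, e3, e4]
    ring
  have hcover : {z | R.eval z ≠ 0} ⊆ F₁ ∪ F₂ := by
    intro z _
    obtain ⟨w, w', hw⟩ := (quadraticDynamics p₁ p₀ z).exists_eq_pair
    rcases hsplit z w w' hw with ⟨-, h1, h2⟩ | ⟨-, h1, h2⟩ | ⟨t, t', ht, ht', -, h1, h2⟩
    · exact Or.inl (by simp only [F₁, Set.mem_ofPred_eq, h1, h2, hunmixed z w w' hw])
    · exact Or.inl (by simp only [F₁, Set.mem_ofPred_eq, h1, h2, add_comm (p₀.eval w'),
        hunmixed z w w' hw])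
    · exact Or.inr (hmixed z w w' t t' hw ht ht' h1 h2)
  by_cases hF : ∃ z, R.eval z ≠ 0 ∧ z ∈ F₁
  · exfalso
    have hall : ∀ z, R.eval z ≠ 0 → z ∉ F₂ := by
      intro z hz hz2
      obtain ⟨z', hz', hz1⟩ := hF
      obtain ⟨y, hy, hy1, hy2⟩ := isPreconnected_closed_iff.1 (isPreconnected_eval_ne_zero hR)
        F₁ F₂ hF₁ hF₂ hcover ⟨z', hz', hz1⟩ ⟨z, hz, hz2⟩
      exact hdisj y hy hy1 hy2
    -- Unmixed, `(σ + 2a) / 2` is `± s b` and `π - c` is `± s d`. One of `b`, `d` is nonzero because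
    -- `R` is, so `D` times a nonzero square has a continuous root near `0`.
    have hsq : ∀ z, R.eval z ≠ 0 → ((σ z + 2 * a.eval z) / 2) ^ 2 = (D * b ^ 2).eval z ∧
        (π z - c.eval z) ^ 2 = (D * d ^ 2).eval z := by
      intro z hz
      obtain ⟨s, hs, h, h1, h2, h3, h4⟩ := key z
      simp only [eval_mul, eval_pow, ← hs]
      rcases hsplit z _ _ h with ⟨e1, e2, -⟩ | ⟨e1, e2, -⟩ | ⟨t, t', ht, ht', -, e1, e2⟩
      · rw [e1, e2, h1, h3]; constructor <;> ring
      · rw [e1, e2, h2, h4]; constructor <;> ring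
      · exact absurd (hmixed z _ _ t t' h ht ht' e1 e2) (hall z hz)
    have hev := eventually_eval_ne_zero hR 0
    have hbd : b ≠ 0 ∨ d ≠ 0 := by
      by_contra! hbd
      exact hR (by simp [R, hbd.1, hbd.2])
    rcases hbd with hb | hd
    · exact not_eventually_sq_eq_eval (odd_rootMultiplicity_mul_sq hodd hb)
        (f := fun z => (σ z + 2 * a.eval z) / 2)
        (Eventually.of_forall fun z => by fun_prop) (hev.mono fun z hz => (hsq z hz).1)
    · exact not_eventually_sq_eq_eval (odd_rootMultiplicity_mul_sq hodd hd)
        (f := fun z => π z - c.eval z)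
        (Eventually.of_forall fun z => by fun_prop) (hev.mono fun z hz => (hsq z hz).2)
  · push Not at hF
    refine ⟨R, σ, π, π', hR, hσ, hπ, hπ', fun z w w' hz hw => ?_⟩
    rcases hsplit z w w' hw with ⟨-, h1, h2⟩ | ⟨-, h1, h2⟩ | ⟨t, t', ht, ht', h1, h2, h3⟩
    · exact absurd (by simp only [F₁, Set.mem_ofPred_eq, h1, h2, hunmixed z w w' hw]) (hF z hz)
    · exact absurd (by simp only [F₁, Set.mem_ofPred_eq, h1, h2, add_comm (p₀.eval w'),
        hunmixed z w w' hw]) (hF z hz)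
    -- `σ + 2p₁(w) = p₁(w) - p₁(w') + t + t'` is a factor of `4 R`.
    · refine ⟨t, t', ht, ht', h1, h2, h3, fun h0 => hz ?_⟩
      have := hres z w w' t t' hw ht ht'
      rw [h1] at h0
      linear_combination -this / 4 + ((p₁.eval w - p₁.eval w') ^ 2 - (t - t') ^ 2) *
        (p₁.eval w - p₁.eval w' - (t + t')) * h0 / 4

/-! ### An odd root of `p₀` in the mixed case. -/

theorem not_isDefinedByAction_of_odd_rootMultiplicity
    (hnd : NonDegenerate (quadraticDynamics p₁ p₀))
    (hodd : Odd ((p₁ ^ 2 - p₀).rootMultiplicity 0)) {z₁ : ℂ} (hz₁ : Odd (p₀.rootMultiplicity z₁)) :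
    ¬ IsDefinedByAction.{u} (quadraticDynamics p₁ p₀) := by
  intro hT
  obtain ⟨R, σ, π, π', hR, hσ, hπ, hπ', hmix⟩ := exists_mixed_splitting hnd hodd hT
  obtain ⟨E, hE, hE0⟩ :=
    exists_eq_pow_rootMultiplicity_mul_eval_ne_zero (ne_zero_of_odd_rootMultiplicity hodd) 0
  obtain ⟨q, hq, hq0⟩ :=
    exists_eq_pow_rootMultiplicity_mul_eval_ne_zero (ne_zero_of_odd_rootMultiplicity hz₁) z₁
  set k := (p₁ ^ 2 - p₀).rootMultiplicity 0
  set m := p₀.rootMultiplicity z₁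
  have hDe : ∀ w, (p₁ ^ 2 - p₀).eval w = w ^ k * E.eval w := fun w => by
    conv_lhs => rw [hE]
    simp
  have hqe : ∀ z, p₀.eval z = (z - z₁) ^ m * q.eval z := fun z => by
    conv_lhs => rw [hq]
    simp
  have hp₀ : p₀.eval z₁ = 0 := by rw [hqe, sub_self, zero_pow hz₁.pos.ne', zero_mul]
  have hev := eventually_eval_ne_zero hR z₁
  by_cases hp : p₁.eval z₁ = 0
  -- Here `T z₁ = {0, 0}`. The continuous function `tt'` has square `D(w) D(w') = p₀ ^ k E(w)
  -- E(w')`, of odd order `m k` at `z₁`.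
  · obtain ⟨N, hN⟩ := exists_eval_mul_eval p₁ p₀ p₁
    obtain ⟨M, hM⟩ := exists_eval_mul_eval p₁ p₀ E
    have hM0 : M.eval z₁ ≠ 0 := by
      obtain ⟨w, w', hw⟩ := (quadraticDynamics p₁ p₀ z₁).exists_eq_pair
      obtain ⟨h1, h2⟩ := quadraticDynamics_vieta hw
      rw [hp] at h1
      rw [hp₀] at h2
      have h3 : w = 0 := by
        have : w ^ 2 = 0 := by linear_combination w * h1 - h2
        simpa using this
      have h4 : w' = 0 := by linear_combination h1 - h3
      rw [← hM z₁ w w' hw, h3, h4]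
      exact mul_ne_zero hE0 hE0
    refine not_eventually_sq_eq_odd_pow_mul (hz₁.mul hodd) (a := z₁)
      (f := fun z => (π z + π' z) / 2 - N.eval z) (u := fun z => q.eval z ^ k * M.eval z)
      (Eventually.of_forall fun z => by fun_prop) (Eventually.of_forall fun z => by fun_prop)
      (mul_ne_zero (pow_ne_zero _ hq0) hM0) ?_
    filter_upwards [hev] with z hz
    obtain ⟨w, w', hw⟩ := (quadraticDynamics p₁ p₀ z).exists_eq_pair
    obtain ⟨t, t', ht, ht', -, h1, h2, -⟩ := hmix z w w' hz hw
    calc ((π z + π' z) / 2 - N.eval z) ^ 2 = t ^ 2 * t' ^ 2 := by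
          rw [h1, h2, ← hN z w w' hw]; ring
      _ = (w * w') ^ k * (E.eval w * E.eval w') := by rw [ht, ht', hDe, hDe]; ring
      _ = _ := by
        rw [(quadraticDynamics_vieta hw).2, hM z w w' hw, hqe, mul_pow, ← pow_mul]; ring
  -- Here `T z₁ = {0, -2p₁(z₁)}` has distinct entries, so there are local branches `w = -p₁ + v`,
  -- vanishing at `z₁`, and `w' = -p₁ - v`, not vanishing there. Thus `w = p₀ / w'` has order `m`
  -- and `D(w)` odd order `m k`.
  · obtain ⟨v, hv1, hv⟩ := exists_sqrt_continuousAt (u := fun z => (p₁ ^ 2 - p₀).eval z) (a := z₁)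
      (t := p₁.eval z₁) (Eventually.of_forall fun z => by fun_prop) (by simp [hp₀]) hp
    have hw' : ∀ᶠ z in 𝓝 z₁, -p₁.eval z - v z ≠ 0 := by
      refine ContinuousAt.eventually_ne ?_ ?_
      · exact ContinuousAt.sub (by fun_prop) hv.self_of_nhds.1
      · rw [hv1]
        intro h
        exact hp (by linear_combination -h / 2)
    -- This `f` is `t`: the entry `x = t - p₁(w)` common to `ν b z` and `T w` satisfies both `x² -
    -- σx + π = 0` and `x² + 2p₁(w)x + p₀(w) = 0`. Subtracting gives `x = (π - p₀(w)) / (σ +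
    -- 2p₁(w))`.
    refine not_eventually_sq_eq_odd_pow_mul (hz₁.mul hodd) (a := z₁)
      (f := fun z => (π z - p₀.eval (-p₁.eval z + v z)) / (σ z + 2 * p₁.eval (-p₁.eval z + v z)) +
        p₁.eval (-p₁.eval z + v z))
      (u := fun z => (q.eval z / (-p₁.eval z - v z)) ^ k * E.eval (-p₁.eval z + v z)) ?_ ?_ ?_ ?_
    · filter_upwards [hev, hv.filter_mono nhdsWithin_le_nhds] with z hz ⟨hv, hvs, _⟩
      have hw := quadraticDynamics_eq p₁ p₀ z (v z) (by simpa using hvs)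
      obtain ⟨t, t', -, -, -, -, -, h⟩ := hmix z _ _ hz hw
      have h0 : ContinuousAt (fun z => -p₁.eval z + v z) z := by fun_prop
      have h1 : ContinuousAt (fun z => p₁.eval (-p₁.eval z + v z)) z :=
        p₁.continuous.continuousAt.comp (f := fun z => -p₁.eval z + v z) h0
      have h2 : ContinuousAt (fun z => p₀.eval (-p₁.eval z + v z)) z :=
        p₀.continuous.continuousAt.comp (f := fun z => -p₁.eval z + v z) h0
      exact ((hπ.continuousAt.sub h2).div (hσ.continuousAt.add (continuousAt_const.mul h1)) h).add h1
    · filter_upwards [hv, hw'] with z ⟨hv, _, _⟩ hw'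
      have h0 : ContinuousAt (fun z => -p₁.eval z + v z) z := by fun_prop
      have h1 : ContinuousAt (fun z => E.eval (-p₁.eval z + v z)) z :=
        E.continuous.continuousAt.comp (f := fun z => -p₁.eval z + v z) h0
      have h2 : ContinuousAt (fun z => -p₁.eval z - v z) z := by fun_prop
      have h3 : ContinuousAt (fun z => q.eval z / (-p₁.eval z - v z)) z :=
        q.continuous.continuousAt.div h2 hw'
      exact (h3.pow k).mul h1
    · refine mul_ne_zero (pow_ne_zero _ (div_ne_zero hq0 hw'.self_of_nhds)) ?_
      rwa [hv1, neg_add_cancel]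
    · filter_upwards [hev, hv.filter_mono nhdsWithin_le_nhds, hw'.filter_mono nhdsWithin_le_nhds]
        with z hz ⟨hv, hvs, _⟩ hw'
      have hw := quadraticDynamics_eq p₁ p₀ z (v z) (by simpa using hvs)
      obtain ⟨t, t', ht, -, h1, h2, -, h⟩ := hmix z _ _ hz hw
      have hf : (π z - p₀.eval (-p₁.eval z + v z)) / (σ z + 2 * p₁.eval (-p₁.eval z + v z)) +
          p₁.eval (-p₁.eval z + v z) = t := by
        rw [← eq_sub_iff_add_eq, div_eq_iff h, h1, h2]
        simp only [eval_sub, eval_pow] at ht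
        linear_combination -ht
      have hwe : -p₁.eval z + v z = (z - z₁) ^ m * q.eval z / (-p₁.eval z - v z) := by
        rw [eq_div_iff hw', ← hqe, (quadraticDynamics_vieta hw).2]
      rw [hf, ht, hDe]
      conv_lhs => enter [1]; rw [hwe]
      rw [mul_div_assoc, mul_pow, ← pow_mul, mul_assoc]

/-! ### Non-degeneracy, and the example `p₁ = z + 1`, `p₀ = 1`. -/

theorem NonDegenerate.not_isSquare (h : NonDegenerate (quadraticDynamics p₁ p₀)) :
    ¬ IsSquare (p₁ ^ 2 - p₀) := by
  rintro ⟨E, hE⟩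
  refine h.1 ⟨fun z => ![-p₁.eval z + E.eval z, -p₁.eval z - E.eval z], ?_, fun z => ?_⟩
  · refine continuous_pi fun i => ?_
    fin_cases i
    · exact (by fun_prop : Continuous fun z => -p₁.eval z + E.eval z)
    · exact (by fun_prop : Continuous fun z => -p₁.eval z - E.eval z)
  · apply Sym.coe_injective
    rw [quadraticDynamics_eq p₁ p₀ z (E.eval z), coe_symProj_two]
    · rfl
    · have := congrArg (eval z) hE
      simp only [eval_sub, eval_pow, eval_mul] at this
      rw [this, pow_two]

/-- Half the difference of two continuous branches would be a continuous square root of `D`. -/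
theorem not_exists_continuous_lift {a : ℂ} (h : Odd ((p₁ ^ 2 - p₀).rootMultiplicity a)) :
    ¬ ∃ f : ℂ → (Fin 2 → ℂ), Continuous f ∧ ∀ z, quadraticDynamics p₁ p₀ z = symProj (f z) := by
  rintro ⟨f, hf, hz⟩
  refine not_eventually_sq_eq_eval h (f := fun z => (f z 0 - f z 1) / 2)
    (Eventually.of_forall fun z => by fun_prop) (Eventually.of_forall fun z => ?_)
  obtain ⟨h1, h2⟩ := quadraticDynamics_vieta ((congrArg _ (hz z)).trans (coe_symProj_two _))
  simp only [eval_sub, eval_pow]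
  linear_combination (f z 0 + f z 1 - 2 * p₁.eval z) * h1 / 4 - h2

theorem odd_rootMultiplicity_X_add_one_sq_sub_one :
    Odd (((X + 1) ^ 2 - 1 : ℂ[X]).rootMultiplicity 0) := by
  have h : ((X + 1) ^ 2 - 1 : ℂ[X]) = X * (X + C 2) := by
    rw [C_ofNat]; ring
  have h0 : (X * (X + C 2) : ℂ[X]) ≠ 0 := mul_ne_zero X_ne_zero (X_add_C_ne_zero 2)
  have h1 : (X + C 2 : ℂ[X]).rootMultiplicity 0 = 0 := rootMultiplicity_eq_zero (by simp)
  have h2 : (X : ℂ[X]).rootMultiplicity 0 = 1 := by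
    simpa using rootMultiplicity_X_sub_C_self (x := (0 : ℂ))
  rw [h, rootMultiplicity_mul h0, h1, h2]
  decide

theorem nonDegenerate_X_add_one : NonDegenerate (quadraticDynamics (X + 1) 1) := by
  refine ⟨not_exists_continuous_lift odd_rootMultiplicity_X_add_one_sq_sub_one, -1, ?_⟩
  have h : (quadraticDynamics (X + 1) 1 (-1) : Multiset ℂ) = {Complex.I, -Complex.I} := by
    rw [quadraticDynamics_eq _ _ _ Complex.I (by simp)]
    simp
  have hpair : ∀ w : ℂ, (X ^ 2 + 2 * X : ℂ[X]).eval w ≠ 0 →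
      (quadraticDynamics (X + 1) 1 w : Multiset ℂ).Nodup := by
    intro w hw
    obtain ⟨s, hs, h⟩ := quadraticDynamics_exists_sqrt (X + 1) 1 w
    rw [h, Multiset.insert_eq_cons, Multiset.nodup_cons, Multiset.mem_singleton]
    refine ⟨fun e => hw ?_, Multiset.nodup_singleton _⟩
    simp only [eval_sub, eval_add, eval_mul, eval_pow, eval_X, eval_one, eval_ofNat] at hs ⊢
    have : s = 0 := by linear_combination e / 2
    rw [this] at hs
    linear_combination -hs
  have hI : Complex.I ^ 2 = -1 := Complex.I_sq
  rw [symApply_of_eq_pair h, Multiset.nodup_add]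
  refine ⟨hpair _ ?_, hpair _ ?_, Multiset.disjoint_left.2 fun {x} h1 h2 => ?_⟩
  · intro e
    simp [Complex.ext_iff] at e
  · intro e
    simp [Complex.ext_iff] at e
  · have hroot : ∀ w, x ∈ (quadraticDynamics (X + 1) 1 w : Multiset ℂ) →
        x ^ 2 + 2 * (w + 1) * x + 1 = 0 := fun w hx => by
      change x ∈ roots _ at hx
      simpa using (mem_roots'.1 hx).2
    have e1 := hroot _ h1
    have e2 := hroot _ h2
    -- A value common to `T(i)` and `T(-i)` would have to be `0`, but the product of the entries is
    -- `p₀ = 1`.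
    have e3 : x * Complex.I = 0 := by linear_combination (e1 - e2) / 4
    rcases mul_eq_zero.1 e3 with rfl | e3
    · simp at e1
    · exact Complex.I_ne_zero e3

theorem not_isDefinedByAction_X_add_one :
    ¬ IsDefinedByAction.{u} (quadraticDynamics (X + 1) 1) := by
  intro hT
  obtain ⟨R, σ, π, π', hR, hσ, hπ, hπ', hmix⟩ := exists_mixed_splitting nonDegenerate_X_add_one
    odd_rootMultiplicity_X_add_one_sq_sub_one hT
  -- From `w w' = 1` and `w + w' = -2(z + 1)` follow `p₁(w) p₁(w') = -2z` and `D(w) D(w') = 1 - 4z`.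
  -- So `f = tt'`, and its square has a simple zero at `1/4`.
  refine not_eventually_sq_eq_odd_pow_mul odd_one (a := 1 / 4)
    (f := fun z => (π z + π' z) / 2 + 2 * z) (u := fun _ => -4)
    (Eventually.of_forall fun z => by fun_prop) (Eventually.of_forall fun z => by fun_prop)
    (by norm_num) ?_
  filter_upwards [eventually_eval_ne_zero hR (1 / 4)] with z hz
  obtain ⟨w, w', hw⟩ := (quadraticDynamics (X + 1) 1 z).exists_eq_pair
  obtain ⟨t, t', ht, ht', -, h1, h2, -⟩ := hmix z w w' hz hw
  obtain ⟨v1, v2⟩ := quadraticDynamics_vieta hw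
  simp only [eval_sub, eval_add, eval_pow, eval_X, eval_one] at ht ht' h1 h2 v1 v2
  have hf : (π z + π' z) / 2 + 2 * z = t * t' := by
    rw [h1, h2]
    linear_combination v1 + v2
  rw [hf, mul_pow, ht, ht']
  have e : ((w + 1) ^ 2 - 1) * ((w' + 1) ^ 2 - 1) = w * w' * (w * w' + 2 * (w + w') + 4) := by
    ring
  rw [e, v1, v2]
  ring

/-! ### Conjugation by homeomorphisms and the normalizing translation. -/

variable {S S' : Type*} [TopologicalSpace S] [TopologicalSpace S'] {m : ℕ}

/-- The dynamics `T` written in the coordinates given by a homeomorphism. -/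
def conjDynamics (φ : S ≃ₜ S') (T : S → Sym S m) (s : S') : Sym S' m :=
  (T (φ.symm s)).map φ

theorem conjDynamics_symm (φ : S ≃ₜ S') (T : S → Sym S m) :
    conjDynamics φ.symm (conjDynamics φ T) = T := by
  funext s
  simp [conjDynamics, Sym.map_map]

theorem symApply_conjDynamics (φ : S ≃ₜ S') (T T' : S → Sym S m) (s : S') :
    symApply (conjDynamics φ T) (conjDynamics φ T' s) =
      (symApply T (T' (φ.symm s))).map φ := by
  simp only [symApply, conjDynamics, Sym.coe_map, Multiset.bind_map, Multiset.map_bind,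
    Homeomorph.symm_apply_apply]

/-- The action `ν` written in the coordinates given by a homeomorphism. -/
def MultivaluedAction.conj {A : Type*} {G : MultivaluedGroup m A} (ν : MultivaluedAction G S)
    (φ : S ≃ₜ S') : MultivaluedAction G S' where
  act a := conjDynamics φ (ν.act a)
  act_act a₁ a₂ s := by
    rw [symApply_conjDynamics, ν.act_act]
    simp only [symApply, conjDynamics, Sym.coe_map, Multiset.map_bind]
  one_act s := by
    simp only [conjDynamics, ν.one_act]
    apply Sym.coe_injective
    simp [Sym.coe_replicate]
  continuous_act a :=
    (Sym.continuous_map φ.continuous).comp ((ν.continuous_act a).comp φ.symm.continuous)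

theorem IsDefinedByAction.conj {T : S → Sym S m} (h : IsDefinedByAction.{u} T) (φ : S ≃ₜ S') :
    IsDefinedByAction.{u} (conjDynamics φ T) := by
  obtain ⟨A, G, ν, a, h⟩ := h
  exact ⟨A, G, ν.conj φ, a, fun s => by rw [conjDynamics, h]; rfl⟩

theorem isDefinedByAction_conjDynamics_iff {T : S → Sym S m} (φ : S ≃ₜ S') :
    IsDefinedByAction.{u} (conjDynamics φ T) ↔ IsDefinedByAction.{u} T :=
  ⟨fun h => by simpa only [conjDynamics_symm] using h.conj φ.symm, fun h => h.conj φ⟩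

theorem NonDegenerate.conj {T : ℂ → Sym ℂ 2} (h : NonDegenerate T) (φ : ℂ ≃ₜ ℂ) :
    NonDegenerate (conjDynamics φ T) := by
  constructor
  · rintro ⟨f, hf, hT⟩
    refine h.1 ⟨fun z i => φ.symm (f (φ z) i), by fun_prop, fun z => ?_⟩
    rw [← Sym.map_symProj, ← hT]
    simp [conjDynamics, Sym.map_map]
  · obtain ⟨z, hz⟩ := h.2
    refine ⟨φ z, ?_⟩
    rw [symApply_conjDynamics, φ.symm_apply_apply]
    exact hz.map φ.injective

theorem quadraticDynamics_translate (p₁ p₀ : ℂ[X]) (a z : ℂ) :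
    quadraticDynamics (p₁.comp (X + C a) + C a)
      (p₀.comp (X + C a) + 2 * C a * p₁.comp (X + C a) + C a ^ 2) z =
        (quadraticDynamics p₁ p₀ (z + a)).map fun w => w - a := by
  obtain ⟨s, hs, h⟩ := quadraticDynamics_exists_sqrt p₁ p₀ (z + a)
  apply Sym.coe_injective
  rw [Sym.coe_map, h, quadraticDynamics_eq _ _ z s]
  · simp only [Multiset.insert_eq_cons, Multiset.map_cons, Multiset.map_singleton, eval_add,
      eval_comp, eval_X, eval_C]
    congr 2 <;> ring
  · simp only [eval_sub, eval_pow] at hs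
    rw [hs]
    simp
    ring

theorem mainTheorem1 :
    -- the criterion, for coordinates in which `0` is a root of odd multiplicity of the radicand
    (∀ p₁ p₀ : ℂ[X], NonDegenerate (quadraticDynamics p₁ p₀) →
      Odd ((p₁ ^ 2 - p₀).rootMultiplicity 0) →
        ((∃ z₁ : ℂ, Odd (p₀.rootMultiplicity z₁)) →
          ¬ IsDefinedByAction.{u} (quadraticDynamics p₁ p₀)) ∧
        (IsDefinedByAction.{u} (quadraticDynamics p₁ p₀) → IsSquare p₀)) ∧
    -- the necessary condition is not sufficient
    (∃ p₁ p₀ : ℂ[X], NonDegenerate (quadraticDynamics p₁ p₀) ∧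
      Odd ((p₁ ^ 2 - p₀).rootMultiplicity 0) ∧ IsSquare p₀ ∧
        ¬ IsDefinedByAction.{u} (quadraticDynamics p₁ p₀)) ∧
    -- every non-degenerate dynamics is brought to such coordinates by a translation
    (∀ p₁ p₀ : ℂ[X], NonDegenerate (quadraticDynamics p₁ p₀) →
      (∃ a : ℂ, Odd ((p₁ ^ 2 - p₀).rootMultiplicity a)) ∧
      ∀ a : ℂ, Odd ((p₁ ^ 2 - p₀).rootMultiplicity a) →
        ∃ q₁ q₀ : ℂ[X],
          (∀ z, quadraticDynamics q₁ q₀ z =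
            (quadraticDynamics p₁ p₀ (z + a)).map (fun w => w - a)) ∧
          NonDegenerate (quadraticDynamics q₁ q₀) ∧
          Odd ((q₁ ^ 2 - q₀).rootMultiplicity 0) ∧
          (IsDefinedByAction.{u} (quadraticDynamics p₁ p₀) ↔
            IsDefinedByAction.{u} (quadraticDynamics q₁ q₀))) := by
  refine ⟨fun p₁ p₀ hnd hodd => ⟨?_, fun hT => ?_⟩, ?_, fun p₁ p₀ hnd => ⟨?_, fun a ha => ?_⟩⟩
  · rintro ⟨z₁, hz₁⟩
    exact not_isDefinedByAction_of_odd_rootMultiplicity hnd hodd hz₁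
  · exact isSquare_of_forall_even_rootMultiplicity fun z₁ hz₁ =>
      not_isDefinedByAction_of_odd_rootMultiplicity hnd hodd hz₁ hT
  · exact ⟨X + 1, 1, nonDegenerate_X_add_one, odd_rootMultiplicity_X_add_one_sq_sub_one,
      IsSquare.one, not_isDefinedByAction_X_add_one⟩
  · by_contra! h
    exact hnd.not_isSquare (isSquare_of_forall_even_rootMultiplicity fun a ha =>
      h a ha)
  · have h : quadraticDynamics _ _ = conjDynamics (Homeomorph.subRight a) _ :=
      funext (quadraticDynamics_translate p₁ p₀ a)
    refine ⟨_, _, quadraticDynamics_translate p₁ p₀ a, ?_, ?_, ?_⟩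
    · rw [h]
      exact hnd.conj _
    · rw [rootMultiplicity_eq_rootMultiplicity] at ha
      -- Shifting `w` preserves the discriminant, so the radicand is only translated in `z`.
      have e : (p₁.comp (X + C a) + C a) ^ 2 -
          (p₀.comp (X + C a) + 2 * C a * p₁.comp (X + C a) + C a ^ 2) =
            (p₁ ^ 2 - p₀).comp (X + C a) := by
        simp only [sub_comp, pow_comp]
        ring
      rwa [e]
    · rw [h]
      exact (isDefinedByAction_conjDynamics_iff _).symm
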